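/- Let $G$ be a $q\times r$ matrix of real rational functions of $z$, let $p_1,\dots,p_r\in[0,1)$ and $\mu=\mathrm{diag}\{1-p_1,\dots,1-p_r\}$. Suppose that $G\mu=C(zI-A)^{-1}B$ with real matrices $A$ ($n\times n$), $B$ ($n\times r$), $C$ ($q\times n$) such that $\{A,B\}$ is controllable and $\{A,C\}$ is detectable. A real square matrix is called stable if all its eigenvalues lie in the open unit disc; $\mathcal{RH}_\infty$ denotes the proper real rational functions (or matrices of such) all of whose poles lie in the open unit disc. A right coprime factorization of $G\mu$ is a pair $N,M\in\mathcal{RH}_\infty$ with $M$ invertible as a rational matrix, $G\mu=NM^{-1}$, and $XM+YN=I$ for some $X,Y\in\mathcal{RH}_\infty$. A Wonham decomposition of $\{A,B\}$ consists of sizes $l_1,\dots,l_r\ge 0$ with $\sum_j l_j=n$ and an invertible real $T$ such that $A_w=TAT^{-1}$ and $B_w=TB$ are block upper triangular, with $j$-th diagonal blocks $$A_j=\begin{bmatrix}0&1&\cdots&0\\ \vdots&&\ddots&\vdots\\ 0&0&\cdots&1\\ -a_{jl_j}&-a_{j(l_j-1)}&\cdots&-a_{j1}\end{bmatrix}\in\mathbb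 R^{l_j\times l_j},\qquad b_j=\begin{bmatrix}0\\ \vdots\\ 0\\ 1\end{bmatrix}\in\mathbb R^{l_j}$$ respectively (the $j$-th block of columns of $B_w$ being its $j$-th column); put $C_w=CT^{-1}$. If $l_j=0$ the block is empty. Then: 1. A Wonham decomposition of $\{A,B\}$ exists. 2. For every Wonham decomposition there are real row vectors $f_j\in\mathbb R^{1\times l_j}$ such that $A_j-b_jf_j$ is stable for all $j=1,\dots,r$. 3. For every Wonham decomposition and all such $f_1,\dots,f_r$, put $F=\mathrm{diag}\{f_1,\dots,f_r\}$ (block diagonal). Then $$M=I-F(zI-A_w+B_wF)^{-1}B_w,\qquad N=C_w(zI-A_w+B_wF)^{-1}B_w$$ form a right coprime factorization $G\mu=NM^{-1}$, the matrix $M$ is upper triangular, and its diagonal entries are $$m_{jj}=1-f_j(zI-A_j+b_jf_j)^{-1}b_j,\qquad j=1,\dots,r.$$ 4. If $A$ has no eigenvalue on the unit circle, then for every Wonham decomposition the $f_j$ in item 2 can be chosen so that, with $N,M$ as in item 3 and suitable nonzero real constants $c_1,\dots,c_r$, $\Lambda=\mathrm{diag}\{c_1,\dots,c_r\}$, the pair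 $N\Lambda,\ M\Lambda$ is a right coprime factorization of $G\mu$ with $M\Lambda$ upper triangular, whose diagonal entries $c_jm_{jj}$ are scalar inner functions (that is, $g\in\mathcal{RH}_\infty$ and $g(1/z)g(z)=1$), namely $$c_jm_{jj}(z)=\prod_{i}\frac{z-\lambda_{ji}}{\bar\lambda_{ji}z-1},\qquad |z|\ge 1,$$ where $\lambda_{j1},\lambda_{j2},\dots$ are the eigenvalues of $A_j$ outside the closed unit disc, counted with multiplicity. -/

import Mathlib

noncomputable section

namespace NetCtrl

open scoped Matrix

/-- A real matrix, viewed as a constant matrix of real rational functions of `z`. -/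
def constMat {ι κ : Type*} (A : Matrix ι κ ℝ) : Matrix ι κ (RatFunc ℝ) :=
  A.map (fun x => (RatFunc.C x : RatFunc ℝ))

/-- `z I`, where `z` is the indeterminate of the field of real rational functions. -/
def zI (ι : Type*) [DecidableEq ι] : Matrix ι ι (RatFunc ℝ) :=
  (RatFunc.X : RatFunc ℝ) • (1 : Matrix ι ι (RatFunc ℝ))

/-- The transfer matrix `C (zI - A)⁻¹ B` of the state-space model `(A, B, C, 0)`. -/
def transferMatrix {ι κ ω : Type*} [Fintype ι] [DecidableEq ι]
    (A : Matrix ι ι ℝ) (B : Matrix ι κ ℝ) (C : Matrix ω ι ℝ) : Matrix ω κ (RatFunc ℝ) :=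
  constMat C * (zI ι - constMat A)⁻¹ * constMat B

/-- A real square matrix is (discrete-time) stable if all its complex eigenvalues lie in the
open unit disc. -/
def IsSchurStable {ι : Type*} [Fintype ι] [DecidableEq ι] (A : Matrix ι ι ℝ) : Prop :=
  ∀ z ∈ spectrum ℂ (A.map (fun x => (x : ℂ))), ‖z‖ < 1

/-- The controllability matrix `[B, AB, …, A^(n-1) B]`. -/
def ctrbMatrix {n r : ℕ} (A : Matrix (Fin n) (Fin n) ℝ) (B : Matrix (Fin n) (Fin r) ℝ) :
    Matrix (Fin n) (Fin n × Fin r) ℝ :=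
  Matrix.of fun i kj => (A ^ (kj.1 : ℕ) * B) i kj.2

/-- Controllability of the pair `{A, B}`. -/
def IsControllable {n r : ℕ} (A : Matrix (Fin n) (Fin n) ℝ) (B : Matrix (Fin n) (Fin r) ℝ) :
    Prop :=
  (ctrbMatrix A B).rank = n

/-- Detectability of the pair `{A, C}`. -/
def IsDetectable {n q : ℕ} (A : Matrix (Fin n) (Fin n) ℝ) (C : Matrix (Fin q) (Fin n) ℝ) :
    Prop :=
  ∃ L : Matrix (Fin n) (Fin q) ℝ, IsSchurStable (A + L * C)

/-- Scalar members of `RH∞`: proper real rational functions all of whose (complex) poles lie in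
the open unit disc. -/
def IsRHInf (m : RatFunc ℝ) : Prop :=
  m.num.natDegree ≤ m.denom.natDegree ∧
    ∀ z : ℂ, Polynomial.aeval z m.denom = 0 → ‖z‖ < 1

/-- Matrices over `RH∞`. -/
def IsRHInfMat {ι κ : Type*} (M : Matrix ι κ (RatFunc ℝ)) : Prop :=
  ∀ i j, IsRHInf (M i j)

/-- `P = N M⁻¹` is a right coprime factorization over `RH∞`: `N` and `M` have entries in `RH∞`,
`M` is invertible as a matrix of rational functions, and a Bezout identity `X M + Y N = I` holds
with `X`, `Y` over `RH∞`. -/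
def IsRightCoprimeFactorization {ω κ : Type*} [Fintype ω] [Fintype κ] [DecidableEq κ]
    (P N : Matrix ω κ (RatFunc ℝ)) (M : Matrix κ κ (RatFunc ℝ)) : Prop :=
  IsRHInfMat N ∧ IsRHInfMat M ∧ M.det ≠ 0 ∧ P = N * M⁻¹ ∧
    ∃ (X : Matrix κ κ (RatFunc ℝ)) (Y : Matrix κ ω (RatFunc ℝ)),
      IsRHInfMat X ∧ IsRHInfMat Y ∧ X * M + Y * N = 1

/-- `m^~(z) = m(1/z)` for a real rational function `m`. -/
def paraConj (m : RatFunc ℝ) : RatFunc ℝ :=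
  m.eval (algebraMap ℝ (RatFunc ℝ)) (RatFunc.X)⁻¹

/-- A scalar inner function: `m ∈ RH∞` and `m^~ m = 1`. -/
def IsInner (m : RatFunc ℝ) : Prop :=
  IsRHInf m ∧ paraConj m * m = 1

/-- The companion matrix with ones on the superdiagonal and last row `-a 0, …, -a (l-1)`; its
characteristic polynomial is `z^l + a (l-1) z^(l-1) + ⋯ + a 0`. -/
def companionBlock {l : ℕ} (a : Fin l → ℝ) : Matrix (Fin l) (Fin l) ℝ :=
  Matrix.of fun i k =>
    if (i : ℕ) + 1 = l then -a k else if (k : ℕ) = (i : ℕ) + 1 then 1 else 0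

/-- The column `(0, …, 0, 1)ᵀ` of length `l`. -/
def lastUnit (l : ℕ) : Fin l → ℝ :=
  fun i => if (i : ℕ) + 1 = l then 1 else 0

/-- A Wonham decomposition of the pair `{A, B}`: a state transformation `T` (with inverse `S`)
such that `A_w = T A S` and `B_w = T B` are block upper triangular, the `j`-th diagonal block of
`A_w` being a companion matrix `A_j` of size `l j` and the `j`-th diagonal block of `B_w` being
`b_j = (0, …, 0, 1)ᵀ`. Blocks of size zero are allowed. -/
structure WonhamDecomposition {n r : ℕ} (A : Matrix (Fin n) (Fin n) ℝ)
    (B : Matrix (Fin n) (Fin r) ℝ) where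
  l : Fin r → ℕ
  T : Matrix (Σ j : Fin r, Fin (l j)) (Fin n) ℝ
  S : Matrix (Fin n) (Σ j : Fin r, Fin (l j)) ℝ
  T_mul_S : T * S = 1
  S_mul_T : S * T = 1
  a : (j : Fin r) → Fin (l j) → ℝ
  A_lower : ∀ (i j : Fin r) (s : Fin (l i)) (t : Fin (l j)), j < i →
    (T * A * S) ⟨i, s⟩ ⟨j, t⟩ = 0
  A_diag : ∀ (j : Fin r) (s t : Fin (l j)),
    (T * A * S) ⟨j, s⟩ ⟨j, t⟩ = companionBlock (a j) s t
  B_lower : ∀ (i j : Fin r) (s : Fin (l i)), j < i → (T * B) ⟨i, s⟩ j = 0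
  B_diag : ∀ (j : Fin r) (s : Fin (l j)), (T * B) ⟨j, s⟩ j = lastUnit (l j) s

namespace WonhamDecomposition

variable {n r q : ℕ} {A : Matrix (Fin n) (Fin n) ℝ} {B : Matrix (Fin n) (Fin r) ℝ}

/-- The state matrix `A_w`. -/
def Aw (W : WonhamDecomposition A B) :
    Matrix (Σ j : Fin r, Fin (W.l j)) (Σ j : Fin r, Fin (W.l j)) ℝ :=
  W.T * A * W.S

/-- The input matrix `B_w`. -/
def Bw (W : WonhamDecomposition A B) : Matrix (Σ j : Fin r, Fin (W.l j)) (Fin r) ℝ :=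
  W.T * B

/-- The output matrix `C_w`. -/
def Cw (W : WonhamDecomposition A B) (C : Matrix (Fin q) (Fin n) ℝ) :
    Matrix (Fin q) (Σ j : Fin r, Fin (W.l j)) ℝ :=
  C * W.S

/-- The diagonal block `A_j`. -/
def blockA (W : WonhamDecomposition A B) (j : Fin r) : Matrix (Fin (W.l j)) (Fin (W.l j)) ℝ :=
  companionBlock (W.a j)

/-- The diagonal block `b_j`. -/
def blockB (W : WonhamDecomposition A B) (j : Fin r) : Fin (W.l j) → ℝ :=
  lastUnit (W.l j)

/-- The block diagonal gain `F = diag(f_1, …, f_r)`. -/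
def gain (W : WonhamDecomposition A B) (f : (j : Fin r) → Fin (W.l j) → ℝ) :
    Matrix (Fin r) (Σ j : Fin r, Fin (W.l j)) ℝ :=
  Matrix.of fun i js => if i = js.1 then f js.1 js.2 else 0

/-- The row vectors `f_j` are stabilizing: every `A_j - b_j f_j` is stable. -/
def IsStabilizing (W : WonhamDecomposition A B) (f : (j : Fin r) → Fin (W.l j) → ℝ) : Prop :=
  ∀ j, IsSchurStable (W.blockA j - Matrix.vecMulVec (W.blockB j) (f j))

/-- `M = I - F (zI - A_w + B_w F)⁻¹ B_w`. -/
def factorM (W : WonhamDecomposition A B) (f : (j : Fin r) → Fin (W.l j) → ℝ) :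
    Matrix (Fin r) (Fin r) (RatFunc ℝ) :=
  1 - constMat (W.gain f) *
    (zI _ - constMat W.Aw + constMat W.Bw * constMat (W.gain f))⁻¹ * constMat W.Bw

/-- `N = C_w (zI - A_w + B_w F)⁻¹ B_w`. -/
def factorN (W : WonhamDecomposition A B) (C : Matrix (Fin q) (Fin n) ℝ)
    (f : (j : Fin r) → Fin (W.l j) → ℝ) : Matrix (Fin q) (Fin r) (RatFunc ℝ) :=
  constMat (W.Cw C) *
    (zI _ - constMat W.Aw + constMat W.Bw * constMat (W.gain f))⁻¹ * constMat W.Bw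

/-- `m_jj = 1 - f_j (zI - A_j + b_j f_j)⁻¹ b_j`. -/
def diagEntry (W : WonhamDecomposition A B) (f : (j : Fin r) → Fin (W.l j) → ℝ) (j : Fin r) :
    RatFunc ℝ :=
  1 - (fun k => (RatFunc.C (f j k) : RatFunc ℝ)) ⬝ᵥ
    ((zI _ - constMat (W.blockA j) +
        constMat (Matrix.vecMulVec (W.blockB j) (f j)))⁻¹ *ᵥ
      (fun k => (RatFunc.C (W.blockB j k) : RatFunc ℝ)))

open Classical in
/-- The unstable eigenvalues of `A_j` (those outside the open unit disc), with multiplicity. -/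
def unstableEigs (W : WonhamDecomposition A B) (j : Fin r) : Multiset ℂ :=
  (((W.blockA j).map (fun x => (x : ℂ))).charpoly.roots).filter (fun w => 1 ≤ ‖w‖)

end WonhamDecomposition

end NetCtrl

end

/-! ### Closure properties of `RH∞` and resolvents of stable matrices -/

namespace NetCtrl

open Polynomial

/-! The coprime factorization is the classical state-space one. Let `F` make `A - B F` stable, let
`L` make `A + L C` stable, and let `Q`, `P` be the resolvents of these two matrices. Then `M = I - F
Q B` has inverse `I + F (zI - A)⁻¹ B`, and `X = I + F P B`, `Y = -F P L` solve the Bezout equation.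
Both facts are instances of the second resolvent identity
(`isRightCoprimeFactorization_of_stabilizing`).

In Wonham coordinates a block diagonal `F` keeps the closed loop block triangular. Stability is
therefore decided block by block, `M` is upper triangular, and by the matrix determinant lemma
`m_jj` is the quotient of the characteristic polynomials of `A_j` and `A_j - b_j f_j`
(`diagEntry_eq_div`). For a companion pair the gain only shifts coefficients, so this denominator
can be any monic polynomial of degree `l_j`. The choice `z ^ l_j` is stabilizing. Keeping the stable
roots of `A_j` and reflecting the unstable ones in the unit circle leaves, up to a constant, a
Blaschke product (`exists_stable_isInner_div`).

For existence of the decomposition, filter the state space by the spans `V_j` of the orbits of the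
first `j` columns of `B`. Cayley–Hamilton on `V_(j+1) / V_j` gives a monic polynomial that sends
`b_j` into `V_j`, and its Horner quotients applied to `b_j` give the companion block modulo `V_j`
(`exists_companion_vectors`). Controllability makes the last `V_j` the whole space, and a dimension
count turns the resulting spanning family into a basis (`exists_wonham_basis`). -/

theorem isRHInf_div {a b : ℝ[X]} (hb : b ≠ 0) (hab : a.natDegree ≤ b.natDegree)
    (hroot : ∀ z : ℂ, aeval z b = 0 → ‖z‖ < 1) :
    IsRHInf (algebraMap ℝ[X] (RatFunc ℝ) a / algebraMap ℝ[X] (RatFunc ℝ) b) := by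
  refine ⟨?_, fun z hz => hroot z ?_⟩
  · rcases eq_or_ne a 0 with rfl | ha
    · simp
    -- `intDegree` is blind to cancellation, so the degree bound passes to the reduced fraction.
    · have h1 := RatFunc.intDegree_div (RatFunc.algebraMap_ne_zero ha) (RatFunc.algebraMap_ne_zero hb)
      rw [RatFunc.intDegree_polynomial, RatFunc.intDegree_polynomial, RatFunc.intDegree] at h1
      omega
  · obtain ⟨c, hc⟩ := RatFunc.denom_div_dvd a b
    rw [hc, map_mul, hz, zero_mul]

theorem isRHInf_C (c : ℝ) : IsRHInf (RatFunc.C c) := by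
  simp [IsRHInf]

theorem isRHInf_one : IsRHInf 1 := by
  simp [IsRHInf]

theorem isRHInf_zero : IsRHInf 0 := by
  simp [IsRHInf]

theorem IsRHInf.mul {x y : RatFunc ℝ} (hx : IsRHInf x) (hy : IsRHInf y) : IsRHInf (x * y) := by
  have h : x * y = algebraMap ℝ[X] (RatFunc ℝ) (x.num * y.num) /
      algebraMap ℝ[X] (RatFunc ℝ) (x.denom * y.denom) := by
    rw [map_mul, map_mul, mul_div_mul_comm, RatFunc.num_div_denom, RatFunc.num_div_denom]
  rw [h]
  refine isRHInf_div (mul_ne_zero x.denom_ne_zero y.denom_ne_zero) ?_ fun z hz => ?_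
  · rw [natDegree_mul x.denom_ne_zero y.denom_ne_zero]
    exact natDegree_mul_le.trans (add_le_add hx.1 hy.1)
  · rw [map_mul, mul_eq_zero] at hz
    exact hz.elim (hx.2 z) (hy.2 z)

theorem IsRHInf.add {x y : RatFunc ℝ} (hx : IsRHInf x) (hy : IsRHInf y) : IsRHInf (x + y) := by
  have h : x + y = algebraMap ℝ[X] (RatFunc ℝ) (x.num * y.denom + x.denom * y.num) /
      algebraMap ℝ[X] (RatFunc ℝ) (x.denom * y.denom) := by
    conv_lhs => rw [← RatFunc.num_div_denom x, ← RatFunc.num_div_denom y]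
    rw [map_mul, map_add, map_mul, map_mul, div_add_div _ _
      (RatFunc.algebraMap_ne_zero x.denom_ne_zero) (RatFunc.algebraMap_ne_zero y.denom_ne_zero)]
  rw [h]
  refine isRHInf_div (mul_ne_zero x.denom_ne_zero y.denom_ne_zero) ?_ fun z hz => ?_
  · rw [natDegree_mul x.denom_ne_zero y.denom_ne_zero]
    exact natDegree_add_le_of_degree_le
      (natDegree_mul_le.trans (add_le_add hx.1 le_rfl))
      (natDegree_mul_le.trans (add_le_add le_rfl hy.1))
  · rw [map_mul, mul_eq_zero] at hz
    exact hz.elim (hx.2 z) (hy.2 z)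

theorem IsRHInf.neg {x : RatFunc ℝ} (hx : IsRHInf x) : IsRHInf (-x) := by
  simpa using (isRHInf_C (-1)).mul hx

theorem isRHInf_sum {ι : Type*} (s : Finset ι) (f : ι → RatFunc ℝ) (h : ∀ i ∈ s, IsRHInf (f i)) :
    IsRHInf (∑ i ∈ s, f i) :=
  Finset.sum_induction f IsRHInf (fun _ _ => IsRHInf.add) isRHInf_zero h

section Matrices

variable {ι κ ω : Type*}

theorem isRHInfMat_constMat (A : Matrix ι κ ℝ) : IsRHInfMat (constMat A) :=
  fun i j => isRHInf_C (A i j)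

theorem isRHInfMat_one [DecidableEq ι] : IsRHInfMat (1 : Matrix ι ι (RatFunc ℝ)) := by
  intro i j
  rw [Matrix.one_apply]
  split_ifs
  exacts [isRHInf_one, isRHInf_zero]

theorem IsRHInfMat.add {M N : Matrix ι κ (RatFunc ℝ)} (hM : IsRHInfMat M) (hN : IsRHInfMat N) :
    IsRHInfMat (M + N) :=
  fun i j => (hM i j).add (hN i j)

theorem IsRHInfMat.neg {M : Matrix ι κ (RatFunc ℝ)} (hM : IsRHInfMat M) : IsRHInfMat (-M) :=
  fun i j => (hM i j).neg

theorem IsRHInfMat.sub {M N : Matrix ι κ (RatFunc ℝ)} (hM : IsRHInfMat M) (hN : IsRHInfMat N) :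
    IsRHInfMat (M - N) :=
  sub_eq_add_neg M N ▸ hM.add hN.neg

theorem IsRHInfMat.mul [Fintype κ] {M : Matrix ι κ (RatFunc ℝ)} {N : Matrix κ ω (RatFunc ℝ)}
    (hM : IsRHInfMat M) (hN : IsRHInfMat N) : IsRHInfMat (M * N) :=
  fun i j => by
    rw [Matrix.mul_apply]
    exact isRHInf_sum _ _ fun k _ => (hM i k).mul (hN k j)

theorem constMat_mul [Fintype κ] (A : Matrix ι κ ℝ) (B : Matrix κ ω ℝ) :
    constMat (A * B) = constMat A * constMat B :=
  Matrix.map_mul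

theorem constMat_add (A B : Matrix ι κ ℝ) : constMat (A + B) = constMat A + constMat B :=
  Matrix.map_add _ (map_add _) A B

theorem constMat_sub (A B : Matrix ι κ ℝ) : constMat (A - B) = constMat A - constMat B :=
  Matrix.map_sub _ (map_sub _) A B

theorem constMat_one [DecidableEq ι] : constMat (1 : Matrix ι ι ℝ) = 1 :=
  Matrix.map_one _ (map_zero _) (map_one _)

variable [Fintype ι] [DecidableEq ι]

theorem zI_sub_constMat (A : Matrix ι ι ℝ) :
    zI ι - constMat A = A.charmatrix.map (algebraMap ℝ[X] (RatFunc ℝ)) := by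
  ext i j
  by_cases h : i = j
  · subst h
    simp [zI, constMat, Matrix.charmatrix_apply_eq]
  · simp [zI, constMat, Matrix.charmatrix_apply_ne _ _ _ h, Matrix.one_apply_ne h]

theorem det_zI_sub_constMat (A : Matrix ι ι ℝ) :
    (zI ι - constMat A).det = algebraMap ℝ[X] (RatFunc ℝ) A.charpoly := by
  rw [zI_sub_constMat, Matrix.charpoly, RingHom.map_det, RingHom.mapMatrix_apply]

theorem isUnit_det_zI_sub_constMat (A : Matrix ι ι ℝ) : IsUnit (zI ι - constMat A).det := by
  rw [det_zI_sub_constMat]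
  exact (RatFunc.algebraMap_ne_zero A.charpoly_monic.ne_zero).isUnit

/-- An adjugate entry is the determinant of the characteristic matrix with one row made constant, a
matrix of the form `X P + Q` with `P`, `Q` real. The crude bound is enough, since only properness is
needed. -/
theorem natDegree_adjugate_charmatrix_le (A : Matrix ι ι ℝ) (i j : ι) :
    (A.charmatrix.adjugate i j).natDegree ≤ Fintype.card ι := by
  have h : A.charmatrix.updateRow j (Pi.single i 1) =
      (X : ℝ[X]) • ((1 : Matrix ι ι ℝ).updateRow j 0).map C
        + ((-A).updateRow j (Pi.single i 1)).map C := by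
    ext k l
    by_cases hk : k = j
    · subst hk
      by_cases hl : l = i
      · subst hl
        simp
      · simp [hl]
    · by_cases hl : k = l
      · subst hl
        simp [hk, sub_eq_add_neg]
      · simp [hk, hl]
  rw [Matrix.adjugate_apply, h]
  exact natDegree_det_X_add_C_le _ _

theorem isSchurStable_iff (A : Matrix ι ι ℝ) :
    IsSchurStable A ↔ ∀ z : ℂ, aeval z A.charpoly = 0 → ‖z‖ < 1 := by
  have h : A.map (fun x => (x : ℂ)) = A.map (algebraMap ℝ ℂ) := rfl
  simp only [IsSchurStable, h, Matrix.mem_spectrum_iff_isRoot_charpoly, Matrix.charpoly_map, IsRoot,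
    eval_map_algebraMap]

/-- Cramer's rule: adjugate entries over the characteristic polynomial, whose roots are the
eigenvalues. -/
theorem IsSchurStable.isRHInfMat_resolvent {A : Matrix ι ι ℝ} (hA : IsSchurStable A) :
    IsRHInfMat (zI ι - constMat A)⁻¹ := by
  intro i j
  have h : (zI ι - constMat A)⁻¹ i j = algebraMap ℝ[X] (RatFunc ℝ) (A.charmatrix.adjugate i j) /
      algebraMap ℝ[X] (RatFunc ℝ) A.charpoly := by
    rw [Matrix.inv_def, det_zI_sub_constMat, zI_sub_constMat, Ring.inverse_eq_inv',
      ← RingHom.mapMatrix_apply, ← RingHom.map_adjugate]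
    simp [div_eq_inv_mul]
  rw [h]
  refine isRHInf_div A.charpoly_monic.ne_zero ?_ ((isSchurStable_iff A).1 hA)
  rw [A.charpoly_natDegree_eq_dim]
  exact natDegree_adjugate_charmatrix_le A i j

end Matrices

end NetCtrl

/-! ### Change of coordinates and the state-space coprime factorization -/

namespace NetCtrl

open Polynomial

variable {ι κ ω : Type*} [Fintype ι] [DecidableEq ι] [Fintype κ] [DecidableEq κ]

/-- `T` and `S` relate different index types (later a sigma type and `Fin n`), so both one-sided
inverse relations are needed. -/
theorem charpoly_similar {R : Type*} [CommRing R] (A : Matrix κ κ R) {T : Matrix ι κ R}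
    {S : Matrix κ ι R} (hTS : T * S = 1) (hST : S * T = 1) :
    (T * A * S).charpoly = A.charpoly := by
  have hTS' : T.map C * S.map C = 1 := by
    rw [← Matrix.map_mul, hTS, Matrix.map_one _ (map_zero _) (map_one _)]
  have hST' : S.map C * T.map C = 1 := by
    rw [← Matrix.map_mul, hST, Matrix.map_one _ (map_zero _) (map_one _)]
  have h : (T * A * S).charmatrix = T.map C * A.charmatrix * S.map C := by
    rw [Matrix.charmatrix, Matrix.charmatrix, Matrix.mul_sub, Matrix.sub_mul]
    congr 1
    · rw [Matrix.scalar_apply, Matrix.scalar_apply, ← Matrix.smul_one_eq_diagonal,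
        ← Matrix.smul_one_eq_diagonal, Matrix.mul_smul, Matrix.smul_mul, Matrix.mul_one, hTS']
    · simp only [RingHom.mapMatrix_apply, Matrix.map_mul]
  rw [Matrix.charpoly, Matrix.charpoly, h, Matrix.det_conj_of_mul_eq_one hTS' hST']

theorem isSchurStable_similar {A : Matrix κ κ ℝ} (hA : IsSchurStable A) {T : Matrix ι κ ℝ}
    {S : Matrix κ ι ℝ} (hTS : T * S = 1) (hST : S * T = 1) : IsSchurStable (T * A * S) := by
  rw [isSchurStable_iff] at hA ⊢
  rwa [charpoly_similar A hTS hST]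

theorem resolvent_similar (A : Matrix κ κ ℝ) {T : Matrix ι κ ℝ}
    {S : Matrix κ ι ℝ} (hTS : T * S = 1) (hST : S * T = 1) :
    (zI ι - constMat (T * A * S))⁻¹ = constMat T * (zI κ - constMat A)⁻¹ * constMat S := by
  have hTS' : constMat T * constMat S = 1 := by rw [← constMat_mul, hTS, constMat_one]
  have hST' : constMat S * constMat T = 1 := by rw [← constMat_mul, hST, constMat_one]
  refine Matrix.inv_eq_right_inv ?_
  have h : zI ι - constMat (T * A * S) = constMat T * (zI κ - constMat A) * constMat S := by
    rw [Matrix.mul_sub, Matrix.sub_mul, constMat_mul, constMat_mul]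
    simp [zI, hTS']
  rw [h]
  calc _ = constMat T * ((zI κ - constMat A) * ((constMat S * constMat T) *
        (zI κ - constMat A)⁻¹)) * constMat S := by simp only [Matrix.mul_assoc]
    _ = 1 := by
      rw [hST', Matrix.one_mul, Matrix.mul_nonsing_inv _ (isUnit_det_zI_sub_constMat A),
        Matrix.mul_one, hTS']

theorem transferMatrix_similar (A : Matrix κ κ ℝ) {m : Type*} (B : Matrix κ m ℝ) (C : Matrix ω κ ℝ)
    {T : Matrix ι κ ℝ} {S : Matrix κ ι ℝ} (hTS : T * S = 1) (hST : S * T = 1) :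
    transferMatrix (T * A * S) (T * B) (C * S) = transferMatrix A B C := by
  have hST' : constMat S * constMat T = 1 := by rw [← constMat_mul, hST, constMat_one]
  rw [transferMatrix, transferMatrix, resolvent_similar A hTS hST, constMat_mul, constMat_mul]
  calc _ = constMat C * ((constMat S * constMat T) * ((zI κ - constMat A)⁻¹ *
        ((constMat S * constMat T) * constMat B))) := by simp only [Matrix.mul_assoc]
    _ = _ := by simp only [hST', Matrix.one_mul, Matrix.mul_assoc]

/-- The second resolvent identity. -/
theorem inv_sub_inv_eq_mul (P Q : Matrix ι ι (RatFunc ℝ)) (hP : IsUnit P.det) (hQ : IsUnit Q.det) :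
    P⁻¹ - Q⁻¹ = P⁻¹ * (Q - P) * Q⁻¹ := by
  rw [Matrix.mul_sub, Matrix.sub_mul, Matrix.nonsing_inv_mul _ hP, Matrix.mul_assoc,
    Matrix.mul_nonsing_inv _ hQ, Matrix.mul_one, Matrix.one_mul]

/-- State feedback `F` stabilizing `A - B F` and output injection `L` stabilizing `A + L C`
give a right coprime factorization of the transfer matrix. -/
theorem isRightCoprimeFactorization_of_stabilizing [Fintype ω] (A : Matrix ι ι ℝ)
    (B : Matrix ι κ ℝ) (C : Matrix ω ι ℝ) (F : Matrix κ ι ℝ) (L : Matrix ι ω ℝ)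
    (hF : IsSchurStable (A - B * F)) (hL : IsSchurStable (A + L * C)) :
    IsRightCoprimeFactorization (transferMatrix A B C)
      (constMat C * (zI ι - constMat A + constMat B * constMat F)⁻¹ * constMat B)
      (1 - constMat F * (zI ι - constMat A + constMat B * constMat F)⁻¹ * constMat B) := by
  have e1 : zI ι - constMat A + constMat B * constMat F = zI ι - constMat (A - B * F) := by
    rw [constMat_sub, constMat_mul]; abel
  rw [e1]
  have hRu := isUnit_det_zI_sub_constMat A
  have hQu := isUnit_det_zI_sub_constMat (A - B * F)
  have hPu := isUnit_det_zI_sub_constMat (A + L * C)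
  have hQs := hF.isRHInfMat_resolvent
  have hPs := hL.isRHInfMat_resolvent
  have hRQ := inv_sub_inv_eq_mul _ _ hQu hRu
  have hPQ := inv_sub_inv_eq_mul _ _ hPu hQu
  have d1 : (zI ι - constMat A) - (zI ι - constMat (A - B * F))
      = - (constMat B * constMat F) := by
    rw [constMat_sub, constMat_mul]; abel
  have d2 : (zI ι - constMat (A - B * F)) - (zI ι - constMat (A + L * C))
      = constMat B * constMat F + constMat L * constMat C := by
    rw [constMat_sub, constMat_add, constMat_mul, constMat_mul]; abel
  rw [d1] at hRQ
  rw [d2] at hPQ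
  rw [transferMatrix]
  set R := (zI ι - constMat A)⁻¹
  set Q := (zI ι - constMat (A - B * F))⁻¹
  set P := (zI ι - constMat (A + L * C))⁻¹
  have hR : R = Q + Q * (constMat B * constMat F) * R := by
    rw [Matrix.mul_neg, Matrix.neg_mul, sub_eq_iff_eq_add, neg_add_eq_sub, eq_sub_iff_add_eq] at hRQ
    exact hRQ.symm
  -- The inverse of `M` is explicit; multiplying out leaves the resolvent identity `hR` between `F`
  -- and `B`.
  have hMinv : (1 - constMat F * Q * constMat B) * (1 + constMat F * R * constMat B) = 1 := by
    have : constMat F * R * constMat B = constMat F * Q * constMat B +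
        constMat F * Q * constMat B * (constMat F * R * constMat B) := by
      conv_lhs => rw [hR]
      simp only [Matrix.mul_add, Matrix.add_mul, Matrix.mul_assoc]
    rw [Matrix.sub_mul, Matrix.one_mul, Matrix.mul_add, Matrix.mul_one]
    nth_rewrite 1 [this]
    abel
  -- The Bezout witnesses use the observer resolvent `P`. Their identity is `P = Q + P (B F + L C)
  -- Q` between `F` and `B`.
  refine ⟨((isRHInfMat_constMat C).mul hQs).mul (isRHInfMat_constMat B),
    isRHInfMat_one.sub (((isRHInfMat_constMat F).mul hQs).mul (isRHInfMat_constMat B)), ?_, ?_,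
    1 + constMat F * P * constMat B, - (constMat F * P * constMat L),
    isRHInfMat_one.add (((isRHInfMat_constMat F).mul hPs).mul (isRHInfMat_constMat B)),
    (((isRHInfMat_constMat F).mul hPs).mul (isRHInfMat_constMat L)).neg, ?_⟩
  · intro h0
    have := congrArg Matrix.det hMinv
    rw [Matrix.det_mul, h0, zero_mul, Matrix.det_one] at this
    exact zero_ne_one this
  · rw [Matrix.inv_eq_right_inv hMinv]
    conv_lhs => rw [hR]
    simp only [Matrix.mul_add, Matrix.add_mul, Matrix.mul_assoc, Matrix.mul_one]
  · have hP : P = Q + P * (constMat B * constMat F + constMat L * constMat C) * Q := by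
      rw [← hPQ]; abel
    have : constMat F * P * constMat B = constMat F * Q * constMat B +
        constMat F * P * constMat B * (constMat F * Q * constMat B) +
        constMat F * P * constMat L * (constMat C * Q * constMat B) := by
      conv_lhs => rw [hP]
      simp only [Matrix.mul_add, Matrix.add_mul, Matrix.mul_assoc, add_assoc]
    rw [Matrix.add_mul, Matrix.one_mul, Matrix.mul_sub, Matrix.mul_one, Matrix.neg_mul]
    nth_rewrite 1 [this]
    abel

/-- A nonsingular constant diagonal matrix is a unit over `RH∞`: it cancels in `N M⁻¹`, and its
inverse is absorbed into `X` and `Y`. -/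
theorem IsRightCoprimeFactorization.mul_diagonal [Fintype ω] {P N : Matrix ω κ (RatFunc ℝ)}
    {M : Matrix κ κ (RatFunc ℝ)} (h : IsRightCoprimeFactorization P N M) {c : κ → ℝ}
    (hc : ∀ j, c j ≠ 0) :
    IsRightCoprimeFactorization P (N * constMat (Matrix.diagonal c))
      (M * constMat (Matrix.diagonal c)) := by
  obtain ⟨hN, hM, hdet, hP, X, Y, hX, hY, hXY⟩ := h
  have h1 : constMat (Matrix.diagonal c) * constMat (Matrix.diagonal fun j => (c j)⁻¹) = 1 := by
    rw [← constMat_mul, Matrix.diagonal_mul_diagonal, ← constMat_one]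
    simp [hc]
  have h2 : constMat (Matrix.diagonal fun j => (c j)⁻¹) * constMat (Matrix.diagonal c) = 1 := by
    rw [← constMat_mul, Matrix.diagonal_mul_diagonal, ← constMat_one]
    simp [hc]
  refine ⟨hN.mul (isRHInfMat_constMat _), hM.mul (isRHInfMat_constMat _), ?_, ?_,
    constMat (Matrix.diagonal fun j => (c j)⁻¹) * X, constMat (Matrix.diagonal fun j => (c j)⁻¹) * Y,
    (isRHInfMat_constMat _).mul hX, (isRHInfMat_constMat _).mul hY, ?_⟩
  · rw [Matrix.det_mul]
    refine mul_ne_zero hdet fun h0 => ?_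
    have := congrArg Matrix.det h1
    rw [Matrix.det_mul, h0, zero_mul, Matrix.det_one] at this
    exact zero_ne_one this
  · rw [Matrix.mul_inv_rev, Matrix.inv_eq_right_inv h1, ← Matrix.mul_assoc, Matrix.mul_assoc N, h1,
      Matrix.mul_one, hP]
  · rw [← Matrix.mul_assoc, ← Matrix.mul_assoc, ← Matrix.add_mul, Matrix.mul_assoc,
      Matrix.mul_assoc _ Y, ← Matrix.mul_add, hXY, Matrix.mul_one, h2]

end NetCtrl

/-! ### Block triangular matrices indexed by a sigma type -/

namespace NetCtrl

open Polynomial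

section BlockTriangular

variable {r : ℕ} {l : Fin r → ℕ}

/-- The `j`-th diagonal block of a matrix indexed by a sigma type. -/
def diagBlock {R : Type*} (M : Matrix (Σ j : Fin r, Fin (l j)) (Σ j : Fin r, Fin (l j)) R)
    (j : Fin r) : Matrix (Fin (l j)) (Fin (l j)) R :=
  Matrix.of fun s t => M ⟨j, s⟩ ⟨j, t⟩

@[simp]
theorem diagBlock_apply {R : Type*} (M : Matrix (Σ j : Fin r, Fin (l j)) (Σ j : Fin r, Fin (l j)) R)
    (j : Fin r) (s t : Fin (l j)) : diagBlock M j s t = M ⟨j, s⟩ ⟨j, t⟩ :=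
  rfl

theorem charpoly_eq_prod_diagBlock {R : Type*} [CommRing R]
    {M : Matrix (Σ j : Fin r, Fin (l j)) (Σ j : Fin r, Fin (l j)) R}
    (hM : M.BlockTriangular Sigma.fst) : M.charpoly = ∏ j, (diagBlock M j).charpoly := by
  rw [Matrix.charpoly, hM.charmatrix.det_fintype]
  refine Finset.prod_congr rfl fun j _ => ?_
  rw [← Matrix.charmatrix_toSquareBlock, ← Matrix.charpoly,
    ← Matrix.charpoly_reindex (Equiv.sigmaSubtype j) (M.toSquareBlock Sigma.fst j)]
  rfl

/-- In the sum over intermediate blocks `k`, triangularity of `M` kills `k < j` and that of `N`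
kills `k > j`. -/
theorem diagBlock_mul {R : Type*} [CommRing R]
    {M N : Matrix (Σ j : Fin r, Fin (l j)) (Σ j : Fin r, Fin (l j)) R}
    (hM : M.BlockTriangular Sigma.fst) (hN : N.BlockTriangular Sigma.fst) (j : Fin r) :
    diagBlock (M * N) j = diagBlock M j * diagBlock N j := by
  ext s t
  rw [diagBlock_apply, Matrix.mul_apply, Matrix.mul_apply, Fintype.sum_sigma,
    Finset.sum_eq_single j]
  · rfl
  · intro k _ hk
    refine Finset.sum_eq_zero fun u _ => ?_
    rcases lt_or_gt_of_ne hk with h | h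
    · rw [hM (i := ⟨j, s⟩) (j := ⟨k, u⟩) h, zero_mul]
    · rw [hN (i := ⟨k, u⟩) (j := ⟨j, t⟩) h, mul_zero]
  · simp

theorem diagBlock_inv {R : Type*} [CommRing R]
    {M : Matrix (Σ j : Fin r, Fin (l j)) (Σ j : Fin r, Fin (l j)) R}
    (hM : M.BlockTriangular Sigma.fst) (hdet : IsUnit M.det) :
    M⁻¹.BlockTriangular Sigma.fst ∧ ∀ j, diagBlock M⁻¹ j = (diagBlock M j)⁻¹ := by
  let := Matrix.invertibleOfIsUnitDet M hdet
  have hinv := Matrix.blockTriangular_inv_of_blockTriangular hM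
  refine ⟨hinv, fun j => (Matrix.inv_eq_right_inv ?_).symm⟩
  rw [← diagBlock_mul hM hinv, Matrix.mul_nonsing_inv _ hdet]
  ext s t
  simp [Matrix.one_apply]

end BlockTriangular

/-! ### Companion blocks and pole placement -/

section Companion

variable {l : ℕ}

theorem single_zero_vecMul_companionBlock_pow (a : Fin l → ℝ) (h0 : 0 < l) {k : ℕ} (hk : k < l) :
    Matrix.vecMul (Pi.single ⟨0, h0⟩ 1) (companionBlock a ^ k) = Pi.single ⟨k, hk⟩ 1 := by
  induction k with
  | zero => simp
  | succ k ih =>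
    rw [pow_succ, ← Matrix.vecMul_vecMul, ih (by omega)]
    ext i
    simp only [Matrix.single_one_vecMul, Matrix.row_apply, companionBlock, Matrix.of_apply,
      Pi.single_apply, Fin.ext_iff]
    rw [if_neg (by omega)]

/-- Multiply Cayley–Hamilton on the left by the first unit row. That row is cyclic: the powers below
`l` turn it into the successive unit rows and the `l`-th power into `-a`, so the coefficients can be
compared entrywise. -/
theorem charpoly_companionBlock_coeff (a : Fin l → ℝ) (k : Fin l) :
    (companionBlock a).charpoly.coeff k = a k := by
  have h0 : 0 < l := k.pos
  have hd : (companionBlock a).charpoly.natDegree = l := by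
    rw [Matrix.charpoly_natDegree_eq_dim, Fintype.card_fin]
  have hl : (companionBlock a).charpoly.coeff l = 1 := by
    have := (companionBlock a).charpoly_monic.coeff_natDegree
    rwa [hd] at this
  have h := congrArg (Matrix.vecMul (Pi.single ⟨0, h0⟩ 1))
    (Matrix.aeval_self_charpoly (companionBlock a))
  rw [aeval_eq_sum_range, hd, Finset.sum_range_succ, hl, one_smul, Finset.sum_range,
    Matrix.vecMul_add, Matrix.vecMul_zero, Matrix.vecMul_sum] at h
  have hpow : Matrix.vecMul (Pi.single ⟨0, h0⟩ 1) (companionBlock a ^ l) = -a := by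
    obtain ⟨m, rfl⟩ : ∃ m, l = m + 1 := ⟨l - 1, by omega⟩
    rw [pow_succ, ← Matrix.vecMul_vecMul,
      single_zero_vecMul_companionBlock_pow a h0 (Nat.lt_succ_self m)]
    ext i
    simp [companionBlock]
  have hterm : ∀ i : Fin l, Matrix.vecMul (Pi.single ⟨0, h0⟩ (1 : ℝ))
      ((companionBlock a).charpoly.coeff i • companionBlock a ^ (i : ℕ)) =
      Pi.single i ((companionBlock a).charpoly.coeff i) := fun i => by
    rw [Matrix.vecMul_smul, single_zero_vecMul_companionBlock_pow a h0 i.2]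
    simp [← Pi.single_smul]
  rw [Finset.sum_congr rfl fun i _ => hterm i, hpow] at h
  have hk := congrFun h k
  simp only [Pi.add_apply, Finset.sum_apply, Pi.single_apply, Pi.neg_apply, Pi.zero_apply] at hk
  simp only [Finset.sum_ite_eq, Finset.mem_univ, if_true] at hk
  linarith

theorem companionBlock_sub_vecMulVec (a f : Fin l → ℝ) :
    companionBlock a - Matrix.vecMulVec (lastUnit l) f = companionBlock (a + f) := by
  ext i k
  simp only [companionBlock, lastUnit, Matrix.sub_apply, Matrix.of_apply, Matrix.vecMulVec_apply,
    Pi.add_apply]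
  split_ifs <;> ring

/-- Pole placement for a companion pair. -/
theorem exists_charpoly_companionBlock_sub_eq (a : Fin l → ℝ) {d : ℝ[X]} (hd : d.Monic)
    (hdeg : d.natDegree = l) :
    ∃ f : Fin l → ℝ,
      (companionBlock a - Matrix.vecMulVec (lastUnit l) f).charpoly = d := by
  refine ⟨fun k => d.coeff k - a k, ?_⟩
  rw [companionBlock_sub_vecMulVec]
  set g : Fin l → ℝ := a + fun k : Fin l => d.coeff k - a k with hg
  have hc : (companionBlock g).charpoly.natDegree = l := by
    rw [Matrix.charpoly_natDegree_eq_dim, Fintype.card_fin]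
  ext k
  rcases lt_trichotomy k l with h | h | h
  · simpa [hg] using charpoly_companionBlock_coeff g ⟨k, h⟩
  · have h1 := hd.coeff_natDegree
    have h2 := (companionBlock g).charpoly_monic.coeff_natDegree
    rw [hdeg] at h1
    rw [hc] at h2
    rw [h, h1, h2]
  · rw [coeff_eq_zero_of_natDegree_lt (hc.trans_lt h),
      coeff_eq_zero_of_natDegree_lt (hdeg.trans_lt h)]

end Companion

/-! ### Feedback in Wonham coordinates -/

namespace WonhamDecomposition

variable {n r q : ℕ} {A : Matrix (Fin n) (Fin n) ℝ} {B : Matrix (Fin n) (Fin r) ℝ}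
  (W : WonhamDecomposition A B)

theorem blockTriangular_Aw : W.Aw.BlockTriangular Sigma.fst :=
  fun i j h => W.A_lower i.1 j.1 i.2 j.2 h

theorem diagBlock_Aw (j : Fin r) : diagBlock W.Aw j = W.blockA j := by
  ext s t
  exact (diagBlock_apply _ _ _ _).trans (W.A_diag j s t)

/-- Carries the absence of unit-circle eigenvalues from `A` to each block. -/
theorem charpoly_eq_prod_blockA : A.charpoly = ∏ j, (W.blockA j).charpoly := by
  rw [← charpoly_similar A W.T_mul_S W.S_mul_T]
  exact (charpoly_eq_prod_diagBlock W.blockTriangular_Aw).trans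
    (Finset.prod_congr rfl fun j _ => by rw [W.diagBlock_Aw])

variable (f : (j : Fin r) → Fin (W.l j) → ℝ)

theorem Bw_mul_gain_apply (i : Σ j : Fin r, Fin (W.l j)) (j : Fin r) (t : Fin (W.l j)) :
    (W.Bw * W.gain f) i ⟨j, t⟩ = W.Bw i j * f j t := by
  simp [Matrix.mul_apply, gain]

theorem blockTriangular_closedLoop : (W.Aw - W.Bw * W.gain f).BlockTriangular Sigma.fst :=
  W.blockTriangular_Aw.sub fun i j h => by
    obtain ⟨j, t⟩ := j
    rw [Bw_mul_gain_apply, Bw, W.B_lower i.1 j i.2 h, zero_mul]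

theorem diagBlock_closedLoop (j : Fin r) : diagBlock (W.Aw - W.Bw * W.gain f) j =
    W.blockA j - Matrix.vecMulVec (W.blockB j) (f j) := by
  ext s t
  rw [diagBlock_apply, Matrix.sub_apply, Matrix.sub_apply, Bw_mul_gain_apply,
    ← W.diagBlock_Aw, Bw, W.B_diag]
  rfl

theorem IsStabilizing.isSchurStable {W : WonhamDecomposition A B}
    {f : (j : Fin r) → Fin (W.l j) → ℝ} (hf : W.IsStabilizing f) :
    IsSchurStable (W.Aw - W.Bw * W.gain f) := by
  rw [isSchurStable_iff, charpoly_eq_prod_diagBlock (W.blockTriangular_closedLoop f)]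
  intro z hz
  rw [map_prod, Finset.prod_eq_zero_iff] at hz
  obtain ⟨j, -, hj⟩ := hz
  rw [diagBlock_closedLoop] at hj
  exact (isSchurStable_iff _).1 (hf j) z hj

/-- Detectability survives the change of coordinates: `T L` is an output injection for the
transformed pair. -/
theorem isRightCoprimeFactorization (C : Matrix (Fin q) (Fin n) ℝ) (hdet : IsDetectable A C)
    (hf : W.IsStabilizing f) :
    IsRightCoprimeFactorization (transferMatrix A B C) (W.factorN C f) (W.factorM f) := by
  obtain ⟨L, hL⟩ := hdet
  rw [← transferMatrix_similar A B C W.T_mul_S W.S_mul_T]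
  refine isRightCoprimeFactorization_of_stabilizing W.Aw W.Bw (W.Cw C) (W.gain f) (W.T * L)
    hf.isSchurStable ?_
  have h : W.Aw + W.T * L * W.Cw C = W.T * (A + L * C) * W.S := by
    simp only [Aw, Cw, Matrix.mul_add, Matrix.add_mul, Matrix.mul_assoc]
  rw [h]
  exact isSchurStable_similar hL W.T_mul_S W.S_mul_T

theorem zI_sub_Aw_add_eq : zI _ - constMat W.Aw + constMat W.Bw * constMat (W.gain f) =
    zI _ - constMat (W.Aw - W.Bw * W.gain f) := by
  rw [constMat_sub, constMat_mul]
  abel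

theorem blockTriangular_zI_sub {l : Fin r → ℕ}
    {M : Matrix (Σ j : Fin r, Fin (l j)) (Σ j : Fin r, Fin (l j)) ℝ}
    (hM : M.BlockTriangular Sigma.fst) : (zI _ - constMat M).BlockTriangular Sigma.fst := by
  rw [zI_sub_constMat]
  exact hM.charmatrix.map (algebraMap ℝ[X] (RatFunc ℝ))

theorem factorM_apply (i j : Fin r) : W.factorM f i j = (1 : Matrix _ _ (RatFunc ℝ)) i j -
    ∑ s : Fin (W.l i), ∑ t : (Σ j : Fin r, Fin (W.l j)), RatFunc.C (f i s) *
      (zI (Σ j : Fin r, Fin (W.l j)) - constMat (W.Aw - W.Bw * W.gain f))⁻¹ ⟨i, s⟩ t * RatFunc.C (W.Bw t j) := by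
  rw [factorM, zI_sub_Aw_add_eq, Matrix.sub_apply, Matrix.mul_assoc, Matrix.mul_apply,
    Fintype.sum_sigma, Finset.sum_eq_single i]
  · simp [gain, constMat, Matrix.mul_apply, Finset.mul_sum, mul_assoc]
  · intro k _ hk
    simp [gain, constMat, hk.symm]
  · simp

/-- Row `i` of `F` sees only block row `i` of the resolvent. For `j < i`, a block `k < i` is killed
by the triangular resolvent and a block `k ≥ i` by column `j` of `B_w`. -/
theorem isUpperTriangular_factorM : (W.factorM f).IsUpperTriangular := by
  intro i j hij
  change j < i at hij
  obtain ⟨hQ, -⟩ := diagBlock_inv (blockTriangular_zI_sub (W.blockTriangular_closedLoop f))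
    (isUnit_det_zI_sub_constMat _)
  rw [factorM_apply, Matrix.one_apply_ne hij.ne', zero_sub, neg_eq_zero]
  refine Finset.sum_eq_zero fun s _ => Finset.sum_eq_zero fun t _ => ?_
  obtain ⟨k, t⟩ := t
  rcases lt_or_ge k i with h | h
  · rw [hQ (i := ⟨i, s⟩) (j := ⟨k, t⟩) h, mul_zero, zero_mul]
  · rw [Bw, W.B_lower k j t (hij.trans_le h), map_zero, mul_zero]

theorem factorM_apply_self (j : Fin r) : W.factorM f j j = W.diagEntry f j := by
  obtain ⟨hQ, hQd⟩ := diagBlock_inv (blockTriangular_zI_sub (W.blockTriangular_closedLoop f))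
    (isUnit_det_zI_sub_constMat _)
  have hblock : diagBlock (zI _ - constMat (W.Aw - W.Bw * W.gain f)) j =
      zI _ - constMat (W.blockA j) + constMat (Matrix.vecMulVec (W.blockB j) (f j)) := by
    rw [sub_add, ← constMat_sub, ← diagBlock_closedLoop]
    ext s t
    rw [diagBlock_apply, Matrix.sub_apply, Matrix.sub_apply, constMat, constMat, Matrix.map_apply,
      Matrix.map_apply, diagBlock_apply]
    simp [zI, Matrix.one_apply]
  rw [factorM_apply, diagEntry, ← hblock, ← hQd, Matrix.one_apply_eq]
  congr 1
  refine Finset.sum_congr rfl fun s _ => ?_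
  rw [Fintype.sum_sigma, Finset.sum_eq_single j]
  · simp only [Matrix.mulVec, dotProduct, Finset.mul_sum, mul_assoc]
    refine Finset.sum_congr rfl fun t _ => ?_
    rw [Bw, W.B_diag]
    rfl
  · intro k _ hk
    refine Finset.sum_eq_zero fun t _ => ?_
    rcases lt_or_gt_of_ne hk with h | h
    · rw [hQ (i := ⟨j, s⟩) (j := ⟨k, t⟩) h, mul_zero, zero_mul]
    · rw [Bw, W.B_lower k j t h, map_zero, mul_zero]
  · simp

/-- Matrix determinant lemma: `zI - A_j` is the rank-one perturbation of `zI - (A_j - b_j f_j)` by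
`-b_j f_j`. -/
theorem diagEntry_eq_div (j : Fin r) : W.diagEntry f j =
    algebraMap ℝ[X] (RatFunc ℝ) (W.blockA j).charpoly / algebraMap ℝ[X] (RatFunc ℝ)
      (W.blockA j - Matrix.vecMulVec (W.blockB j) (f j)).charpoly := by
  have hu := isUnit_det_zI_sub_constMat (W.blockA j - Matrix.vecMulVec (W.blockB j) (f j))
  rw [eq_div_iff (by rw [← det_zI_sub_constMat]; exact hu.ne_zero), ← det_zI_sub_constMat,
    ← det_zI_sub_constMat]
  have h1 : zI _ - constMat (W.blockA j) =
      zI _ - constMat (W.blockA j - Matrix.vecMulVec (W.blockB j) (f j)) +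
      Matrix.replicateCol Unit (fun k => -(RatFunc.C (W.blockB j k) : RatFunc ℝ)) *
        Matrix.replicateRow Unit (fun k => (RatFunc.C (f j k) : RatFunc ℝ)) := by
    ext s t
    simp [constMat, Matrix.mul_apply, Matrix.vecMulVec_apply]
    ring
  rw [h1, Matrix.det_add_replicateCol_mul_replicateRow hu, mul_comm]
  congr 1
  rw [diagEntry, Matrix.det_unique, sub_add, ← constMat_sub, Matrix.add_apply, Matrix.one_apply_eq,
    Matrix.mul_assoc, sub_eq_add_neg]
  congr 1
  have h2 : (fun k => -(RatFunc.C (W.blockB j k) : RatFunc ℝ)) =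
    -(fun k => (RatFunc.C (W.blockB j k) : RatFunc ℝ)) := rfl
  rw [h2, ← dotProduct_neg, ← Matrix.mulVec_neg]
  rfl

theorem exists_isStabilizing : ∃ f, W.IsStabilizing f := by
  -- Deadbeat choice: all closed-loop eigenvalues are placed at `0`.
  choose f hf using fun j => exists_charpoly_companionBlock_sub_eq (W.a j)
    (monic_X_pow (R := ℝ) (W.l j)) (natDegree_X_pow _)
  refine ⟨f, fun j => (isSchurStable_iff _).2 fun z hz => ?_⟩
  rw [blockA, blockB, hf, map_pow, aeval_X] at hz
  simp [eq_zero_of_pow_eq_zero hz]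

end WonhamDecomposition

end NetCtrl

/-! ### Spectral factorization and inner diagonal entries -/

namespace NetCtrl

open Polynomial ComplexConjugate

/-- `RatFunc.eval` is defined through the reduced fraction; this permits evaluation of any
representing fraction whose denominator does not vanish at the point. -/
theorem eval_div_eq {L : Type} [Field L] (f : ℝ →+* L) (x : L) (a : ℝ[X]) {b : ℝ[X]}
    (hb : b.eval₂ f x ≠ 0) :
    (algebraMap ℝ[X] (RatFunc ℝ) a / algebraMap ℝ[X] (RatFunc ℝ) b).eval f x =
      a.eval₂ f x / b.eval₂ f x := by
  have hb0 : b ≠ 0 := by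
    rintro rfl
    simp at hb
  obtain ⟨c, hc⟩ := RatFunc.denom_div_dvd a b
  have hd : (algebraMap ℝ[X] (RatFunc ℝ) a / algebraMap ℝ[X] (RatFunc ℝ) b).denom.eval₂ f x ≠ 0 := by
    intro h
    rw [hc, eval₂_mul, h, zero_mul] at hb
    exact hb rfl
  rw [RatFunc.eval, div_eq_div_iff hd hb, ← eval₂_mul, ← eval₂_mul,
    (RatFunc.num_mul_eq_mul_denom_iff hb0).2 rfl]

theorem exists_map_eq_of_conj_eq {p : ℂ[X]} (hp : p.map (starRingEnd ℂ) = p) :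
    ∃ q : ℝ[X], q.map (algebraMap ℝ ℂ) = p := by
  rw [← mem_lifts, lifts_iff_coeff_lifts]
  intro n
  have h := congrArg (fun q => coeff q n) hp
  rw [coeff_map] at h
  obtain ⟨r, hr⟩ := Complex.conj_eq_iff_real.1 h
  exact ⟨r, hr.symm⟩

theorem roots_map_conj (a : ℝ[X]) :
    (a.map (algebraMap ℝ ℂ)).roots.map (starRingEnd ℂ) = (a.map (algebraMap ℝ ℂ)).roots := by
  have h := (IsAlgClosed.splits (a.map (algebraMap ℝ ℂ))).roots_map (starRingEnd ℂ)
  rw [← h, Polynomial.map_map]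
  congr 2
  ext x
  simp

theorem filter_roots_map_conj (a : ℝ[X]) (P : ℂ → Prop) [DecidablePred P]
    (hP : ∀ w, P (conj w) ↔ P w) :
    ((a.map (algebraMap ℝ ℂ)).roots.filter P).map (starRingEnd ℂ) =
      (a.map (algebraMap ℝ ℂ)).roots.filter P := by
  conv_rhs => rw [← roots_map_conj]
  rw [Multiset.filter_map]
  congr 1
  exact Multiset.filter_congr fun w _ => (hP w).symm

/-- The selected roots are closed under conjugation, so their product polynomial has real
coefficients. It serves for both the stable and the unstable part. -/
theorem exists_monic_map_eq_prod_filter_roots (a : ℝ[X]) (P : ℂ → Prop) [DecidablePred P]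
    (hP : ∀ w, P (conj w) ↔ P w) :
    ∃ u : ℝ[X], u.Monic ∧ u.map (algebraMap ℝ ℂ) =
      (((a.map (algebraMap ℝ ℂ)).roots.filter P).map fun w => X - C w).prod := by
  obtain ⟨u, hu⟩ := exists_map_eq_of_conj_eq
    (p := (((a.map (algebraMap ℝ ℂ)).roots.filter P).map fun w => X - C w).prod) (by
      rw [Polynomial.map_multiset_prod, Multiset.map_map]
      conv_rhs => rw [← filter_roots_map_conj a P hP, Multiset.map_map]
      simp)
  refine ⟨u, ?_, hu⟩
  have hm : (u.map (algebraMap ℝ ℂ)).Monic := hu ▸ monic_multiset_prod_of_monic _ _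
    fun w _ => monic_X_sub_C w
  exact (monic_map_iff).1 hm

theorem reverse_multiset_prod_X_sub_C (m : Multiset ℂ) :
    (m.map fun w => X - C w).prod.reverse = (m.map fun w => 1 - C w * X).prod := by
  induction m using Multiset.induction_on with
  | empty => simpa using reverse_C (1 : ℂ)
  | cons w m ih =>
    rw [Multiset.map_cons, Multiset.map_cons, Multiset.prod_cons, Multiset.prod_cons,
      reverse_mul_of_domain, ih]
    congr 1
    have h := reverse_X_mul (1 : ℂ[X])
    rw [mul_one, ← C_1, reverse_C] at h
    rw [sub_eq_add_neg, ← C_neg, reverse_add_C, h, natDegree_X, pow_one, C_1, C_neg, neg_mul,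
      ← sub_eq_add_neg]

/-- Spectral factorization: a monic real polynomial without roots on the unit circle can be divided
by a monic stable polynomial of the same degree so that the quotient is inner up to a constant, with
zeros at the unstable roots. -/
theorem exists_stable_isInner_div (a : ℝ[X]) (ha : a.Monic)
    (hcirc : ∀ z : ℂ, aeval z a = 0 → ‖z‖ ≠ 1) [DecidablePred fun w : ℂ => 1 ≤ ‖w‖] :
    ∃ (d : ℝ[X]) (c : ℝ), d.Monic ∧ d.natDegree = a.natDegree ∧
      (∀ z : ℂ, aeval z d = 0 → ‖z‖ < 1) ∧ c ≠ 0 ∧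
      IsInner (RatFunc.C c * (algebraMap ℝ[X] (RatFunc ℝ) a / algebraMap ℝ[X] (RatFunc ℝ) d)) ∧
      ∀ z : ℂ, 1 ≤ ‖z‖ →
        (RatFunc.C c * (algebraMap ℝ[X] (RatFunc ℝ) a / algebraMap ℝ[X] (RatFunc ℝ) d)).eval
          (algebraMap ℝ ℂ) z =
        (((a.map (algebraMap ℝ ℂ)).roots.filter fun w => 1 ≤ ‖w‖).map
          fun w => (z - w) / (conj w * z - 1)).prod := by
  set m := (a.map (algebraMap ℝ ℂ)).roots.filter fun w => 1 ≤ ‖w‖ with hm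
  have hPinv : ∀ w : ℂ, 1 ≤ ‖conj w‖ ↔ 1 ≤ ‖w‖ := fun w => by rw [RCLike.norm_conj]
  have hconj : m.map (starRingEnd ℂ) = m := filter_roots_map_conj a _ hPinv
  -- The filter only gives `1 ≤ ‖w‖`; the hypothesis on the circle makes it strict.
  have hm1 : ∀ w ∈ m, 1 < ‖w‖ := fun w hw => by
    obtain ⟨h1, h2⟩ := Multiset.mem_filter.1 hw
    refine lt_of_le_of_ne h2 (hcirc w ?_).symm
    rw [← eval_map_algebraMap]
    exact isRoot_of_mem_roots h1
  obtain ⟨u, humon, hu⟩ := exists_monic_map_eq_prod_filter_roots a (fun w => 1 ≤ ‖w‖) hPinv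
  obtain ⟨s, hsmon, hs⟩ := exists_monic_map_eq_prod_filter_roots a (fun w => ¬ 1 ≤ ‖w‖)
    fun w => not_congr (hPinv w)
  rw [← hm] at hu
  have hasu : a = s * u := by
    apply map_injective _ (algebraMap ℝ ℂ).injective
    rw [Polynomial.map_mul, hs, hu, ← Multiset.prod_add, ← Multiset.map_add, hm, add_comm,
      Multiset.filter_add_not]
    exact (IsAlgClosed.splits _).eq_prod_roots_of_monic (ha.map _)
  have hsroot : ∀ z : ℂ, aeval z s = 0 → ‖z‖ < 1 := fun z hz => by
    rw [← eval_map_algebraMap, hs, eval_multiset_prod, Multiset.prod_eq_zero_iff] at hz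
    simp only [Multiset.mem_map] at hz
    obtain ⟨q, ⟨w, hw, rfl⟩, hq⟩ := hz
    rw [eval_sub, eval_X, eval_C, sub_eq_zero] at hq
    rw [hq]
    exact not_le.1 (Multiset.mem_filter.1 hw).2
  -- Reversal reflects the roots of `u` in the circle. The sign turns the factors `1 - w z` into `w
  -- z - 1`, and conjugation symmetry of `m` allows `w` to be replaced by its conjugate.
  set v : ℝ[X] := C ((-1) ^ u.natDegree) * u.reverse with hv
  have hdeg : u.natDegree = m.card := by
    rw [← natDegree_map (algebraMap ℝ ℂ), hu, natDegree_multiset_prod_X_sub_C_eq_card]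
  have hvmap : v.map (algebraMap ℝ ℂ) = (m.map fun w => C (conj w) * X - 1).prod := by
    have h1 : (u.reverse).map (algebraMap ℝ ℂ) = (u.map (algebraMap ℝ ℂ)).reverse := by
      ext k
      simp [coeff_reverse]
    rw [hv, Polynomial.map_mul, h1, hu, reverse_multiset_prod_X_sub_C, hdeg]
    conv_rhs => rw [← hconj, Multiset.map_map]
    have h2 : m.map ((fun w => C (conj w) * X - 1) ∘ (starRingEnd ℂ)) =
        (m.map fun w => 1 - C w * X).map Neg.neg := by
      simp
    rw [h2, Multiset.prod_map_neg]
    simp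
  have hveval : ∀ z : ℂ, aeval z v = (m.map fun w => conj w * z - 1).prod := fun z => by
    rw [← eval_map_algebraMap, hvmap, eval_multiset_prod, Multiset.map_map]
    simp
  have hueval : ∀ z : ℂ, aeval z u = (m.map fun w => z - w).prod := fun z => by
    rw [← eval_map_algebraMap, hu, eval_multiset_prod, Multiset.map_map]
    simp
  have hvroot : ∀ z : ℂ, aeval z v = 0 → ‖z‖ < 1 := fun z hz => by
    rw [hveval, Multiset.prod_eq_zero_iff, Multiset.mem_map] at hz
    obtain ⟨w, hw, hq⟩ := hz
    have h1 := congrArg norm (sub_eq_zero.1 hq)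
    rw [norm_mul, RCLike.norm_conj, norm_one] at h1
    have h2 := hm1 w hw
    by_contra! h3
    nlinarith
  -- A nonzero constant term ensures that reversal does not lower the degree.
  have hu0 : u.coeff 0 ≠ 0 := fun h0 => by
    have h1 : aeval (0 : ℂ) u = 0 := by
      rw [aeval_def, eval₂_at_zero, h0, map_zero]
    rw [hueval, Multiset.prod_eq_zero_iff, Multiset.mem_map] at h1
    obtain ⟨w, hw, hq⟩ := h1
    have h2 := hm1 w hw
    rw [zero_sub, neg_eq_zero] at hq
    rw [hq, norm_zero] at h2
    linarith
  have hvne : v ≠ 0 :=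
    mul_ne_zero (C_ne_zero.2 (by simp)) (mt reverse_eq_zero.1 humon.ne_zero)
  have hvdeg : v.natDegree = u.natDegree := by
    rw [hv, natDegree_C_mul (by simp), reverse_natDegree,
      natTrailingDegree_eq_zero_of_constantCoeff_ne_zero hu0, Nat.sub_zero]
  have hlead : v.leadingCoeff ≠ 0 := leadingCoeff_ne_zero.2 hvne
  have hau := RatFunc.algebraMap_ne_zero humon.ne_zero
  have hav := RatFunc.algebraMap_ne_zero hvne
  have has := RatFunc.algebraMap_ne_zero hsmon.ne_zero
  -- The monic denominator is `s` times the normalized `v`; the constant undoes the normalization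
  -- and `s` cancels, leaving `u / v`.
  have hg : RatFunc.C v.leadingCoeff⁻¹ * (algebraMap ℝ[X] (RatFunc ℝ) a /
      algebraMap ℝ[X] (RatFunc ℝ) (s * (v * C v.leadingCoeff⁻¹))) =
      algebraMap ℝ[X] (RatFunc ℝ) u / algebraMap ℝ[X] (RatFunc ℝ) v := by
    have hl : (RatFunc.C v.leadingCoeff⁻¹ : RatFunc ℝ) ≠ 0 := by simpa using hlead
    rw [hasu, map_mul, map_mul, map_mul, RatFunc.algebraMap_C]
    generalize (RatFunc.C v.leadingCoeff⁻¹ : RatFunc ℝ) = k at hl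
    field_simp
  refine ⟨s * (v * C v.leadingCoeff⁻¹), v.leadingCoeff⁻¹,
    hsmon.mul (monic_mul_leadingCoeff_inv hvne), ?_, fun z hz => ?_, inv_ne_zero hlead, ?_, ?_⟩
  · rw [hasu, hsmon.natDegree_mul (monic_mul_leadingCoeff_inv hvne), hsmon.natDegree_mul humon,
      natDegree_mul_C (inv_ne_zero hlead), hvdeg]
  · rw [map_mul, map_mul, aeval_C, mul_eq_zero, mul_eq_zero] at hz
    rcases hz with hz | hz | hz
    · exact hsroot z hz
    · exact hvroot z hz
    · simp [hvne] at hz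
  · rw [hg]
    refine ⟨isRHInf_div hvne hvdeg.ge hvroot, ?_⟩
    have hX : (RatFunc.X : RatFunc ℝ) ≠ 0 := RatFunc.X_ne_zero
    have halg : ∀ p : ℝ[X], p.eval₂ (algebraMap ℝ (RatFunc ℝ)) RatFunc.X =
        algebraMap ℝ[X] (RatFunc ℝ) p := RatFunc.aeval_X_left_eq_algebraMap
    have hrev1 : u.reverse.eval₂ (algebraMap ℝ (RatFunc ℝ)) (RatFunc.X)⁻¹ *
        RatFunc.X ^ u.natDegree = algebraMap ℝ[X] (RatFunc ℝ) u := by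
      let := invertibleOfNonzero hX
      have := eval₂_reverse_mul_pow (algebraMap ℝ (RatFunc ℝ)) RatFunc.X u
      rwa [invOf_eq_inv, halg] at this
    have hrev2 : algebraMap ℝ[X] (RatFunc ℝ) u.reverse * (RatFunc.X)⁻¹ ^ u.natDegree =
        u.eval₂ (algebraMap ℝ (RatFunc ℝ)) (RatFunc.X)⁻¹ := by
      let := invertibleOfNonzero (inv_ne_zero hX)
      have := eval₂_reverse_mul_pow (algebraMap ℝ (RatFunc ℝ)) (RatFunc.X)⁻¹ u
      rwa [invOf_eq_inv, inv_inv, halg] at this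
    have hv1 : v.eval₂ (algebraMap ℝ (RatFunc ℝ)) (RatFunc.X)⁻¹ =
        (-1) ^ u.natDegree * u.reverse.eval₂ (algebraMap ℝ (RatFunc ℝ)) (RatFunc.X)⁻¹ := by
      rw [hv, eval₂_mul, eval₂_C, map_pow, map_neg, map_one]
    have hv2 : algebraMap ℝ[X] (RatFunc ℝ) v =
        (-1) ^ u.natDegree * algebraMap ℝ[X] (RatFunc ℝ) u.reverse := by
      rw [hv, map_mul, C_pow, map_pow, C_neg, map_neg, C_1, map_one]
    have hne : v.eval₂ (algebraMap ℝ (RatFunc ℝ)) (RatFunc.X)⁻¹ ≠ 0 := fun h0 => by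
      rw [hv1, mul_eq_zero] at h0
      rcases h0 with h0 | h0
      · exact pow_ne_zero _ (neg_ne_zero.2 one_ne_zero) h0
      · rw [h0, zero_mul] at hrev1
        exact hau hrev1.symm
    -- Both `u(1/z) u(z)` and `v(1/z) v(z)` reduce to the product of the values of `u.reverse` at
    -- `z` and `1/z`: the powers of `z` cancel in the first and the signs in the second.
    rw [paraConj, eval_div_eq _ _ _ hne, div_mul_div_comm, div_eq_one_iff_eq (mul_ne_zero hne hav),
      hv1, hv2, ← hrev1, ← hrev2]
    have hone : ((-1 : RatFunc ℝ) ^ u.natDegree) * (-1) ^ u.natDegree = 1 := by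
      rw [← mul_pow]; simp
    have hXX : (RatFunc.X : RatFunc ℝ)⁻¹ ^ u.natDegree * RatFunc.X ^ u.natDegree = 1 := by
      rw [← mul_pow, inv_mul_cancel₀ hX, one_pow]
    linear_combination (algebraMap ℝ[X] (RatFunc ℝ) u.reverse *
      u.reverse.eval₂ (algebraMap ℝ (RatFunc ℝ)) (RatFunc.X)⁻¹) * (hXX - hone)
  · intro z hz
    rw [hg, eval_div_eq, ← aeval_def, ← aeval_def, hveval, hueval, Multiset.prod_map_div]
    rw [← aeval_def]
    exact fun h0 => (hvroot z h0).not_ge hz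

namespace WonhamDecomposition

variable {n r q : ℕ} {A : Matrix (Fin n) (Fin n) ℝ} {B : Matrix (Fin n) (Fin r) ℝ}
  (W : WonhamDecomposition A B)

theorem exists_isStabilizing_isInner
    (hA : ∀ z ∈ spectrum ℂ (A.map (fun x => (x : ℂ))), ‖z‖ ≠ 1) :
    ∃ (f : (j : Fin r) → Fin (W.l j) → ℝ) (c : Fin r → ℝ), W.IsStabilizing f ∧ (∀ j, c j ≠ 0) ∧
      ∀ j, IsInner (RatFunc.C (c j) * W.diagEntry f j) ∧
        ∀ z : ℂ, 1 ≤ ‖z‖ → (RatFunc.C (c j) * W.diagEntry f j).eval (algebraMap ℝ ℂ) z =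
          ((W.unstableEigs j).map (fun w => (z - w) / ((starRingEnd ℂ) w * z - 1))).prod := by
  classical
  have hmap : ∀ {ι : Type} [Fintype ι] [DecidableEq ι] (M : Matrix ι ι ℝ),
      (M.map (fun x => (x : ℂ))).charpoly = M.charpoly.map (algebraMap ℝ ℂ) :=
    fun M => Matrix.charpoly_map M (algebraMap ℝ ℂ)
  have hcirc : ∀ j, ∀ z : ℂ, aeval z (W.blockA j).charpoly = 0 → ‖z‖ ≠ 1 := fun j z hz => by
    apply hA
    rw [Matrix.mem_spectrum_iff_isRoot_charpoly, hmap, IsRoot, eval_map_algebraMap,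
      W.charpoly_eq_prod_blockA, map_prod]
    exact Finset.prod_eq_zero (Finset.mem_univ j) hz
  choose d c hd hdeg hstab hc hinner heval using fun j =>
    exists_stable_isInner_div _ (W.blockA j).charpoly_monic (hcirc j)
  choose f hf using fun j => exists_charpoly_companionBlock_sub_eq (W.a j) (hd j)
    ((hdeg j).trans ((Matrix.charpoly_natDegree_eq_dim _).trans (Fintype.card_fin _)))
  have hentry : ∀ j, W.diagEntry f j = algebraMap ℝ[X] (RatFunc ℝ) (W.blockA j).charpoly /
      algebraMap ℝ[X] (RatFunc ℝ) (d j) := fun j => by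
    rw [diagEntry_eq_div, ← hf]
    rfl
  refine ⟨f, c, fun j => (isSchurStable_iff _).2 ?_, hc, fun j => ?_⟩
  · rw [blockA, blockB, hf]
    exact hstab j
  · rw [hentry]
    refine ⟨hinner j, fun z hz => ?_⟩
    rw [heval j z hz, unstableEigs, hmap]

end WonhamDecomposition

end NetCtrl

/-! ### Existence of a Wonham decomposition -/

namespace NetCtrl

open Polynomial Module
open scoped Matrix

section CyclicExtension

variable {E : Type*} [AddCommGroup E] [Module ℝ E]

theorem map_aeval_apply_of_comp_eq {E' : Type*} [AddCommGroup E'] [Module ℝ E'] {f : End ℝ E}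
    {g : End ℝ E'} {φ : E →ₗ[ℝ] E'} (h : ∀ x, φ (f x) = g (φ x)) (p : ℝ[X]) (x : E) :
    φ (aeval f p x) = aeval g p (φ x) := by
  induction p using Polynomial.induction_on' with
  | add p q hp hq => simp [hp, hq]
  | monomial k c =>
    have hk : ∀ k : ℕ, φ ((f ^ k) x) = (g ^ k) (φ x) := fun k => by
      induction k with
      | zero => simp
      | succ k ih => rw [pow_succ', pow_succ', Module.End.mul_apply, Module.End.mul_apply, h, ih]
    simp [aeval_monomial, hk]

/-- The polynomial is the characteristic polynomial of the map induced on the image of `V` in `E /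
U`; Cayley–Hamilton annihilates the class of `b`. -/
theorem exists_monic_aeval_apply_mem [FiniteDimensional ℝ E] (f : End ℝ E) {U V : Submodule ℝ E}
    (hUV : U ≤ V) (hU : U ≤ U.comap f) (hV : V ≤ V.comap f) {b : E} (hb : b ∈ V) :
    ∃ p : ℝ[X], p.Monic ∧ p.natDegree = finrank ℝ V - finrank ℝ U ∧ aeval f p b ∈ U := by
  have hmaps : ∀ x ∈ V.map U.mkQ, U.mapQ U f hU x ∈ V.map U.mkQ := by
    rintro _ ⟨x, hx, rfl⟩
    exact ⟨f x, hV hx, rfl⟩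
  refine ⟨((U.mapQ U f hU).restrict hmaps).charpoly, LinearMap.charpoly_monic _, ?_, ?_⟩
  · rw [LinearMap.charpoly_natDegree]
    have h := LinearMap.finrank_range_add_finrank_ker (U.mkQ.domRestrict V)
    rw [LinearMap.range_domRestrict, LinearMap.ker_domRestrict, Submodule.ker_mkQ,
      (Submodule.comapSubtypeEquivOfLe hUV).finrank_eq] at h
    omega
  · have h1 := map_aeval_apply_of_comp_eq (f := f) (g := U.mapQ U f hU) (φ := U.mkQ)
      (fun _ => rfl) ((U.mapQ U f hU).restrict hmaps).charpoly b
    have h2 := map_aeval_apply_of_comp_eq (f := (U.mapQ U f hU).restrict hmaps)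
      (g := U.mapQ U f hU) (φ := (V.map U.mkQ).subtype)
      (fun _ => rfl) ((U.mapQ U f hU).restrict hmaps).charpoly ⟨U.mkQ b, b, hb, rfl⟩
    rw [LinearMap.aeval_self_charpoly] at h2
    rw [← Submodule.Quotient.mk_eq_zero, ← Submodule.mkQ_apply, h1]
    exact h2.symm.trans (by simp)

/-- The controllable canonical form of a cyclic extension of an invariant subspace. -/
theorem exists_companion_vectors (f : End ℝ E) (U : Submodule ℝ E) (b : E) {l : ℕ} {p : ℝ[X]}
    (hp : p.Monic) (hl : p.natDegree = l) (hpb : aeval f p b ∈ U) :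
    ∃ (a : Fin l → ℝ) (e : Fin l → E),
      (∀ t, f (e t) - ∑ s, companionBlock a s t • e s ∈ U) ∧
      b - ∑ s, lastUnit l s • e s ∈ U := by
  -- The iterates of `divX` are the Horner quotients of `p`.
  have hq : ∀ k m, (divX^[k] p).coeff m = p.coeff (m + k) := fun k => by
    induction k with
    | zero => simp
    | succ k ih =>
      intro m
      rw [Function.iterate_succ_apply', coeff_divX, ih]
      congr 1
      omega
  have hql : divX^[l] p = 1 := by
    ext m
    rw [hq, coeff_one]
    split_ifs with h
    · rw [h, zero_add, ← hl]
      exact hp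
    · exact coeff_eq_zero_of_natDegree_lt (by omega)
  have hstep : ∀ k, f (aeval f (divX^[k + 1] p) b) = aeval f (divX^[k] p) b - p.coeff k • b := by
    intro k
    have h := divX_mul_X_add (divX^[k] p)
    rw [← Function.iterate_succ_apply' divX, hq, zero_add] at h
    conv_rhs => rw [← h]
    rw [mul_comm]
    simp [Algebra.algebraMap_eq_smul_one]
  -- Horner's recursion gives `f e_t = e_(t-1) - p_t b`, with `e_(l-1) = b` because the last
  -- quotient is `1`. For `t = 0` the missing predecessor is `p(f) b`, which lies in `U`.
  set e : Fin l → E := fun t => aeval f (divX^[(t : ℕ) + 1] p) b with he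
  have hlast : 0 < l → ∑ s, lastUnit l s • e s = b := fun h0 => by
    rw [Finset.sum_eq_single ⟨l - 1, by omega⟩]
    · have : l - 1 + 1 = l := by omega
      simp only [lastUnit, he, this, hql, if_true, map_one, one_smul, Module.End.one_apply]
    · intro s _ hs
      rw [lastUnit, if_neg, zero_smul]
      intro h
      exact hs (Fin.ext (by simp; omega))
    · simp
  refine ⟨fun k => p.coeff k, e, fun t => ?_, ?_⟩
  · have h0 : 0 < l := t.pos
    have hcomp : ∀ s, companionBlock (fun k : Fin l => p.coeff k) s t • e s =
        -(p.coeff t • lastUnit l s • e s) + if (t : ℕ) = s + 1 then e s else 0 := fun s => by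
      simp only [companionBlock, Matrix.of_apply, lastUnit]
      split_ifs with h1 h2 h2
      · omega
      · simp
      · simp
      · simp
    rw [Finset.sum_congr rfl fun s _ => hcomp s, Finset.sum_add_distrib, Finset.sum_neg_distrib,
      ← Finset.smul_sum, hlast h0, hstep]
    rcases Nat.eq_zero_or_pos (t : ℕ) with ht | ht
    · rw [Finset.sum_eq_zero fun s _ => if_neg (by omega)]
      simpa [ht] using hpb
    · rw [Finset.sum_eq_single ⟨t - 1, by omega⟩]
      · have : (t : ℕ) - 1 + 1 = t := by omega
        simp only [he, this, if_true]
        rw [sub_sub, add_comm, neg_add_eq_sub, sub_add_cancel, sub_self]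
        exact U.zero_mem
      · intro s _ hs
        refine if_neg fun h => hs (Fin.ext ?_)
        simp
        omega
      · simp
  -- An empty block means `p = 1`, so `b` itself lies in `U`.
  · rcases Nat.eq_zero_or_pos l with h0 | h0
    · subst h0
      rw [show divX^[0] p = p from rfl] at hql
      simpa [hql] using hpb
    · simp [hlast h0]

end CyclicExtension

section WonhamBasis

variable {E : Type*} [AddCommGroup E] [Module ℝ E] {r : ℕ}

/-- The span of the orbits of the first `j` vectors of a family. -/
def orbitSpan (f : End ℝ E) (b : Fin r → E) (j : ℕ) : Submodule ℝ E :=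
  Submodule.span ℝ {x | ∃ (k : ℕ) (i : Fin r), (i : ℕ) < j ∧ (f ^ k) (b i) = x}

theorem orbitSpan_mono (f : End ℝ E) (b : Fin r → E) : Monotone (orbitSpan f b) :=
  fun _ _ h => Submodule.span_mono fun _ ⟨k, i, hi, hx⟩ => ⟨k, i, hi.trans_le h, hx⟩

theorem orbitSpan_zero (f : End ℝ E) (b : Fin r → E) : orbitSpan f b 0 = ⊥ := by
  simp [orbitSpan]

theorem orbitSpan_le_comap (f : End ℝ E) (b : Fin r → E) (j : ℕ) :
    orbitSpan f b j ≤ (orbitSpan f b j).comap f := by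
  rw [orbitSpan, Submodule.span_le]
  rintro _ ⟨k, i, hi, rfl⟩
  exact Submodule.subset_span ⟨k + 1, i, hi, by rw [pow_succ', Module.End.mul_apply]⟩

theorem mem_orbitSpan (f : End ℝ E) (b : Fin r → E) {j : ℕ} {i : Fin r} (h : (i : ℕ) < j) :
    b i ∈ orbitSpan f b j :=
  Submodule.subset_span ⟨0, i, h, by simp⟩

theorem orbitSpan_succ_le (f : End ℝ E) (b : Fin r → E) (j : Fin r) {W : Submodule ℝ E}
    (hW : orbitSpan f b j ≤ W) (hf : ∀ x ∈ W, f x ∈ W) (hb : b j ∈ W) :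
    orbitSpan f b (j + 1) ≤ W := by
  rw [orbitSpan, Submodule.span_le]
  rintro _ ⟨k, i, hi, rfl⟩
  rcases (Nat.lt_succ_iff_lt_or_eq.1 hi) with h | h
  · exact hW (Submodule.subset_span ⟨k, i, h, rfl⟩)
  · rw [Fin.ext h]
    exact Module.End.pow_apply_mem_of_forall_mem k hf _ hb

theorem exists_wonham_basis [FiniteDimensional ℝ E] (f : End ℝ E) (b : Fin r → E)
    (htop : orbitSpan f b r = ⊤) :
    ∃ (l : Fin r → ℕ) (a : (j : Fin r) → Fin (l j) → ℝ) (e : Basis (Σ j : Fin r, Fin (l j)) ℝ E),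
      (∀ (i j : Fin r) (s : Fin (l i)) (t : Fin (l j)), j < i →
        e.repr (f (e ⟨j, t⟩)) ⟨i, s⟩ = 0) ∧
      (∀ (j : Fin r) (s t : Fin (l j)),
        e.repr (f (e ⟨j, t⟩)) ⟨j, s⟩ = companionBlock (a j) s t) ∧
      (∀ (i j : Fin r) (s : Fin (l i)), j < i → e.repr (b j) ⟨i, s⟩ = 0) ∧
      ∀ (j : Fin r) (s : Fin (l j)), e.repr (b j) ⟨j, s⟩ = lastUnit (l j) s := by
  choose p hpm hpd hp using fun j : Fin r => exists_monic_aeval_apply_mem f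
    (orbitSpan_mono f b (Nat.le_succ j)) (orbitSpan_le_comap f b j) (orbitSpan_le_comap f b (j + 1))
    (mem_orbitSpan f b (Nat.lt_succ_self j))
  choose a v hf hb using fun j : Fin r =>
    exists_companion_vectors f (orbitSpan f b j) (b j) (hpm j) (hpd j) (hp j)
  set l : Fin r → ℕ := fun j =>
    finrank ℝ (orbitSpan f b (j + 1)) - finrank ℝ (orbitSpan f b j) with hl
  set w : (Σ j : Fin r, Fin (l j)) → E := fun i => v i.1 i.2 with hw
  have hspan : ∀ k ≤ r, orbitSpan f b k ≤ Submodule.span ℝ (w '' {i | (i.1 : ℕ) < k}) := by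
    intro k
    induction k with
    | zero => simp [orbitSpan_zero]
    | succ k ih =>
      intro hk
      have hmono : Submodule.span ℝ (w '' {i | (i.1 : ℕ) < k}) ≤
          Submodule.span ℝ (w '' {i | (i.1 : ℕ) < k + 1}) :=
        Submodule.span_mono (Set.image_mono fun i (hi : (i.1 : ℕ) < k) => Nat.lt_succ_of_lt hi)
      have hV : Submodule.span ℝ (Set.range (v ⟨k, hk⟩)) ≤
          Submodule.span ℝ (w '' {i | (i.1 : ℕ) < k + 1}) :=
        Submodule.span_mono (by
          rintro _ ⟨t, rfl⟩
          exact ⟨⟨⟨k, hk⟩, t⟩, Nat.lt_succ_self k, rfl⟩)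
      refine le_trans (orbitSpan_succ_le f b ⟨k, hk⟩
        (W := orbitSpan f b k ⊔ Submodule.span ℝ (Set.range (v ⟨k, hk⟩))) le_sup_left ?_ ?_)
        (sup_le ((ih (by omega)).trans hmono) hV)
      -- Modulo `V_k` the map acts on the new vectors by the companion matrix, so the sum is
      -- invariant; it also contains `b_k`, hence all of `V_(k+1)`.
      · suffices h : orbitSpan f b k ⊔ Submodule.span ℝ (Set.range (v ⟨k, hk⟩)) ≤
            (orbitSpan f b k ⊔ Submodule.span ℝ (Set.range (v ⟨k, hk⟩))).comap f from
          fun x hx => h hx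
        refine sup_le ((orbitSpan_le_comap f b k).trans (Submodule.comap_mono le_sup_left)) ?_
        rw [Submodule.span_le]
        rintro _ ⟨t, rfl⟩
        rw [SetLike.mem_coe, Submodule.mem_comap]
        rw [← sub_add_cancel (f (v ⟨k, hk⟩ t)) (∑ s, companionBlock (a ⟨k, hk⟩) s t • v ⟨k, hk⟩ s)]
        exact add_mem (Submodule.mem_sup_left (hf ⟨k, hk⟩ t)) (Submodule.mem_sup_right
          (sum_mem fun s _ => Submodule.smul_mem _ _ (Submodule.subset_span ⟨s, rfl⟩)))
      · rw [← sub_add_cancel (b ⟨k, hk⟩) (∑ s, lastUnit _ s • v ⟨k, hk⟩ s)]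
        exact add_mem (Submodule.mem_sup_left (hb ⟨k, hk⟩)) (Submodule.mem_sup_right
          (sum_mem fun s _ => Submodule.smul_mem _ _ (Submodule.subset_span ⟨s, rfl⟩)))
  -- The block sizes are successive dimension differences and telescope to `dim E`, so spanning
  -- already gives a basis.
  have hcard : Fintype.card (Σ j : Fin r, Fin (l j)) = finrank ℝ E := by
    rw [Fintype.card_sigma]
    simp only [Fintype.card_fin, hl]
    rw [← Finset.sum_range (fun j => finrank ℝ (orbitSpan f b (j + 1)) -
      finrank ℝ (orbitSpan f b j)), Finset.sum_range_tsub
      (f := fun j => finrank ℝ (orbitSpan f b j))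
      (fun i j h => Submodule.finrank_mono (orbitSpan_mono f b h)), htop, orbitSpan_zero]
    simp
  have hw_top : ⊤ ≤ Submodule.span ℝ (Set.range w) := by
    rw [← htop]
    exact (hspan r le_rfl).trans (Submodule.span_mono (Set.image_subset_range _ _))
  set e := basisOfTopLeSpanOfCardEqFinrank w hw_top hcard with he
  have hew : ∀ i, e i = w i := fun i => by
    rw [he, coe_basisOfTopLeSpanOfCardEqFinrank]
  -- `V_j` is contained in the span of the basis vectors of blocks below `j`. Coordinates in blocks
  -- `i ≥ j` can thus be computed modulo `V_j`, where the companion relations hold exactly.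
  have hzero : ∀ (j i : Fin r) (s : Fin (l i)), j ≤ i → ∀ x ∈ orbitSpan f b j,
      e.repr x ⟨i, s⟩ = 0 := by
    intro j i s hji x hx
    have h1 := hspan j j.2.le hx
    rw [← funext hew, Basis.mem_span_image] at h1
    by_contra h2
    have h3 : (i : ℕ) < j := h1 (Finsupp.mem_support_iff.2 h2)
    exact absurd h3 (not_lt.2 hji)
  have hrepr : ∀ (j i : Fin r) (s : Fin (l i)), j ≤ i → ∀ (x : E) (c : Fin (l j) → ℝ),
      x - ∑ t, c t • v j t ∈ orbitSpan f b j →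
      e.repr x ⟨i, s⟩ = ∑ t, c t * (Finsupp.single (⟨j, t⟩ : Σ j : Fin r, Fin (l j)) (1 : ℝ))
        ⟨i, s⟩ := by
    intro j i s hji x c hx
    have h1 := hzero j i s hji _ hx
    have h2 : ∀ t, v j t = e ⟨j, t⟩ := fun t => (hew ⟨j, t⟩).symm
    rw [map_sub, Finsupp.sub_apply, sub_eq_zero] at h1
    rw [h1]
    simp only [h2, map_sum, map_smul, Basis.repr_self, Finsupp.finsetSum_apply, Finsupp.smul_apply,
      smul_eq_mul]
  have hlt : ∀ (j i : Fin r) (s : Fin (l i)) (t : Fin (l j)), j < i →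
      (Finsupp.single (⟨j, t⟩ : Σ j : Fin r, Fin (l j)) (1 : ℝ)) ⟨i, s⟩ = 0 :=
    fun j i s t h => Finsupp.single_eq_of_ne fun h' => h.ne' (congrArg Sigma.fst h')
  have hself : ∀ (j : Fin r) (s : Fin (l j)) (c : Fin (l j) → ℝ),
      ∑ t, c t * (Finsupp.single (⟨j, t⟩ : Σ j : Fin r, Fin (l j)) (1 : ℝ)) ⟨j, s⟩ = c s := by
    intro j s c
    rw [Finset.sum_eq_single s]
    · simp
    · intro t _ ht
      rw [Finsupp.single_eq_of_ne, mul_zero]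
      exact fun h => ht (sigma_mk_injective h).symm
    · simp
  refine ⟨l, a, e, fun i j s t h => ?_, fun j s t => ?_, fun i j s h => ?_, fun j s => ?_⟩
  · rw [hrepr j i s h.le _ _ (by rw [hew]; exact hf j t)]
    exact Finset.sum_eq_zero fun u _ => by rw [hlt j i s u h, mul_zero]
  · rw [hrepr j j s le_rfl _ _ (by rw [hew]; exact hf j t), hself]
  · rw [hrepr j i s h.le _ _ (hb j)]
    exact Finset.sum_eq_zero fun u _ => by rw [hlt j i s u h, mul_zero]
  · rw [hrepr j j s le_rfl _ _ (hb j), hself]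

end WonhamBasis

/-- Full rank makes the columns of the controllability matrix span, and each of them lies on the
orbit of a column of `B`. -/
theorem IsControllable.orbitSpan_eq_top {n r : ℕ} {A : Matrix (Fin n) (Fin n) ℝ}
    {B : Matrix (Fin n) (Fin r) ℝ} (h : IsControllable A B) :
    orbitSpan (Matrix.toLin' A) (fun j => B.col j) r = ⊤ := by
  rw [IsControllable, Matrix.rank_eq_finrank_span_cols] at h
  have h1 : Submodule.span ℝ (Set.range (ctrbMatrix A B).col) = ⊤ :=
    Submodule.eq_top_of_finrank_eq (by rw [h, finrank_fin_fun])
  rw [eq_top_iff, ← h1]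
  refine Submodule.span_mono ?_
  rintro _ ⟨⟨k, j⟩, rfl⟩
  refine ⟨k, j, j.2, ?_⟩
  rw [← Matrix.toLin'_pow, Matrix.toLin'_apply]
  ext i
  simp [ctrbMatrix, Matrix.mulVec, dotProduct, Matrix.mul_apply]

theorem IsControllable.nonempty_wonhamDecomposition {n r : ℕ} {A : Matrix (Fin n) (Fin n) ℝ}
    {B : Matrix (Fin n) (Fin r) ℝ} (h : IsControllable A B) :
    Nonempty (WonhamDecomposition A B) := by
  obtain ⟨l, a, e, hAl, hAd, hBl, hBd⟩ := exists_wonham_basis _ _ h.orbitSpan_eq_top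
  have hT : ∀ x, e.toMatrix (Pi.basisFun ℝ (Fin n)) *ᵥ x = e.repr x := fun x => by
    exact (Pi.basisFun ℝ (Fin n)).toMatrix_mulVec_repr e x
  have hS : ∀ i, ((Pi.basisFun ℝ (Fin n)).toMatrix e).col i = e i := fun i => by
    ext k
    simp [Basis.toMatrix_apply]
  have hTA : ∀ i j, (e.toMatrix (Pi.basisFun ℝ (Fin n)) * A * (Pi.basisFun ℝ (Fin n)).toMatrix e)
      i j = e.repr (Matrix.toLin' A (e j)) i := fun i j => by
    rw [Matrix.toLin'_apply, ← hT, ← hS, Matrix.mulVec_mulVec]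
    rfl
  have hTB : ∀ i j, (e.toMatrix (Pi.basisFun ℝ (Fin n)) * B) i j = e.repr (B.col j) i :=
    fun i j => by
      rw [← hT]
      rfl
  exact ⟨{ l := l
           T := e.toMatrix (Pi.basisFun ℝ (Fin n))
           S := (Pi.basisFun ℝ (Fin n)).toMatrix e
           T_mul_S := e.toMatrix_mul_toMatrix_flip _
           S_mul_T := Basis.toMatrix_mul_toMatrix_flip _ _
           a := a
           A_lower := fun i j s t hij => (hTA _ _).trans (hAl i j s t hij)
           A_diag := fun j s t => (hTA _ _).trans (hAd j s t)
           B_lower := fun i j s hij => (hTB _ _).trans (hBl i j s hij)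
           B_diag := fun j s => (hTB _ _).trans (hBd j s) }⟩

end NetCtrl

theorem mainTheorem7 {n r q : ℕ}
    (G : Matrix (Fin q) (Fin r) (RatFunc ℝ))
    (p : Fin r → ℝ) (hp : ∀ j, 0 ≤ p j ∧ p j < 1)
    (A : Matrix (Fin n) (Fin n) ℝ) (B : Matrix (Fin n) (Fin r) ℝ) (C : Matrix (Fin q) (Fin n) ℝ)
    (hG : G * NetCtrl.constMat (Matrix.diagonal fun j => 1 - p j)
      = NetCtrl.transferMatrix A B C)
    (hctrl : NetCtrl.IsControllable A B) (hdet : NetCtrl.IsDetectable A C) :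
    -- a Wonham decomposition exists
    Nonempty (NetCtrl.WonhamDecomposition A B) ∧
    ∀ W : NetCtrl.WonhamDecomposition A B,
      -- stabilizing gains exist
      (∃ f, W.IsStabilizing f) ∧
      -- each of them gives an upper triangular coprime factorization
      (∀ f, W.IsStabilizing f →
        NetCtrl.IsRightCoprimeFactorization
          (G * NetCtrl.constMat (Matrix.diagonal fun j => 1 - p j))
          (W.factorN C f) (W.factorM f) ∧
        (W.factorM f).IsUpperTriangular ∧
        ∀ j, W.factorM f j j = W.diagEntry f j) ∧
      -- a suitable one gives, after constant scaling of the columns, an inner diagonal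
      ((∀ z ∈ spectrum ℂ (A.map (fun x => (x : ℂ))), ‖z‖ ≠ 1) →
        ∃ (f : (j : Fin r) → Fin (W.l j) → ℝ) (c : Fin r → ℝ),
          W.IsStabilizing f ∧ (∀ j, c j ≠ 0) ∧
          NetCtrl.IsRightCoprimeFactorization
            (G * NetCtrl.constMat (Matrix.diagonal fun j => 1 - p j))
            (W.factorN C f * NetCtrl.constMat (Matrix.diagonal c))
            (W.factorM f * NetCtrl.constMat (Matrix.diagonal c)) ∧
          (W.factorM f * NetCtrl.constMat (Matrix.diagonal c)).IsUpperTriangular ∧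
          ∀ j,
            (W.factorM f * NetCtrl.constMat (Matrix.diagonal c)) j j
              = RatFunc.C (c j) * W.diagEntry f j ∧
            NetCtrl.IsInner (RatFunc.C (c j) * W.diagEntry f j) ∧
            ∀ z : ℂ, 1 ≤ ‖z‖ →
              (RatFunc.C (c j) * W.diagEntry f j).eval (algebraMap ℝ ℂ) z
                = ((W.unstableEigs j).map
                    (fun w => (z - w) / ((starRingEnd ℂ) w * z - 1))).prod) := by
  rw [hG]
  refine ⟨hctrl.nonempty_wonhamDecomposition, fun W => ⟨W.exists_isStabilizing, fun f hf =>
    ⟨W.isRightCoprimeFactorization f C hdet hf, W.isUpperTriangular_factorM f,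
      W.factorM_apply_self f⟩, fun hA => ?_⟩⟩
  obtain ⟨f, c, hf, hc, hinner⟩ := W.exists_isStabilizing_isInner hA
  have hmul : ∀ i j, (W.factorM f * NetCtrl.constMat (Matrix.diagonal c)) i j =
      W.factorM f i j * RatFunc.C (c j) := fun i j => by
    have h : NetCtrl.constMat (Matrix.diagonal c) = Matrix.diagonal fun j => RatFunc.C (c j) :=
      Matrix.diagonal_map (map_zero _)
    rw [h, Matrix.mul_diagonal]
  refine ⟨f, c, hf, hc, (W.isRightCoprimeFactorization f C hdet hf).mul_diagonal hc,
    fun i j hij => ?_, fun j => ⟨?_, hinner j⟩⟩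
  · rw [hmul, W.isUpperTriangular_factorM f hij, zero_mul]
  · rw [hmul, W.factorM_apply_self, mul_comm]
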